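/- **Setting.** Let $\omega$ be a random variable (the scenario) with values in a measurable space $\Omega$, let $d\ge 0$, and let $\psi:\mathbb R^d\times\Omega\to\mathbb R$ be jointly measurable with $\psi(\cdot\,;y)$ integrable over $[0,1)^d$ for every $y\in\Omega$. Let $u_1,u_2,\dots$ be random points, each uniformly distributed on $[0,1)^d$ (but not necessarily independent of each other), such that the sequence $(u_j)_{j\ge1}$ is independent of $\omega$. Put $$g(y)=\int_{[0,1)^d}\psi(u;y)\,du,\qquad \hat g_m(y)=\frac1m\sum_{j=1}^m\psi(u_j;y),$$ and, for $c\in\mathbb R$, $\theta=\mathbb P(g(\omega)>c)$. Fix an integer $\ell_0\ge0$ and $k_0>0$, let $m_\ell=2^{\ell+\ell_0}$, and let $$\tilde P_\ell=\frac{1}{1+\exp\!\big(-k_0r^\ell(\hat g_{m_\ell}(\omega)-c)\big)},\qquad \tilde Y_0=\tilde P_0,\qquad \tilde Y_\ell=\tilde P_\ell-\tilde P_{\ell-1}\ (\ell\ge1),$$ with $r=2$. For $L\ge 0$ and $N_0,\dots,N_L\ge1$ the smoothed MLMC estimator is $$\tilde\theta_{\rm MLMC}=\sum_{\ell=0}^L\frac1{N_\ell}\sum_{i=1}^{N_\ell}\tilde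 Y_\ell^{(i)},$$ where $\tilde Y_\ell^{(1)},\dots,\tilde Y_\ell^{(N_\ell)}$ are iid replications of $\tilde Y_\ell$, independent across levels. Its total cost is $\tilde C=\sum_{\ell=0}^LN_\ell\tilde C_\ell$, where $\tilde C_\ell=a+b\,m_\ell+a'$ is the cost of one sample of $\tilde Y_\ell$, with $a,b,a'\ge0$ the fixed costs of drawing one scenario, of one inner sample, and of the final operations. **Assumptions.** 1. There is a measurable function $\sigma^2:\Omega\to[0,\infty)$ such that $\hat g_m(y)$ is square integrable and $\operatorname{Var}[\hat g_m(y)]\le\sigma^2(y)/m^{\eta}$ with $\eta=2$, for all $m\ge1$ and $y\in\Omega$. 2. The random variable $|g(\omega)-c|/\sigma(\omega)$ has a density $\rho$ (in particular $\sigma(\omega)>0$ almost surely), and there are $\rho_0,x_0>0$ with $\rho(x)\le\rho_0$ for all $x\in[0,x_0]$. 3. There is $\delta_0>0$ such that for each $\ell\ge0$ the random variable $\hat g_{m_\ell}(\omega)-c$ has a density $\pi_\ell$ on $(-\delta_0,\delta_0)$, and $\sup_{\ell}\sup_{|x|<\delta_0}\pi_\ell(x)<\infty$. **Theorem.** Under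 these assumptions there is a constant $c_4>0$ such that for every $0<\epsilon<1/e$ there are $L\ge0$ and $N_0,\dots,N_L\ge1$ for which $$\mathbb E\big[(\tilde\theta_{\rm MLMC}-\theta)^2\big]\le\epsilon^2\qquad\text{and}\qquad \tilde C\le c_4\,\epsilon^{-2}(\log\epsilon)^2 .$$ -/

import Mathlib

open MeasureTheory ProbabilityTheory
open scoped NNReal ENNReal

namespace NestedMLMC

/-- The half-open unit cube `[0,1)^d`. -/
def unitCube (d : ℕ) : Set (Fin d → ℝ) := Set.univ.pi fun _ => Set.Ico (0 : ℝ) 1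

/-- The conditional expectation `g(y) = E[X | ω = y] = ∫_{[0,1)^d} ψ(u; y) du`. -/
noncomputable def condMean {Ω : Type*} {d : ℕ} (ψ : (Fin d → ℝ) → Ω → ℝ) (y : Ω) : ℝ :=
  ∫ u in unitCube d, ψ u y

/-- The nested simulation setting on a probability space `(S, P)`. The scenario `scen` (the
outer random variable `ω`) takes values in `Ω`. The points `U 0, U 1, …` of the inner rule are
random vectors, each uniformly distributed over `[0,1)^d`, and the whole sequence is independent
of the scenario. Nothing is assumed about the dependence of the points on each other, so both
plain Monte Carlo (iid points) and randomized quasi-Monte Carlo sequences are covered. -/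
structure IsNestedSimulation {S Ω : Type*} [MeasurableSpace S] [MeasurableSpace Ω] {d : ℕ}
    (P : Measure S) (scen : S → Ω) (U : ℕ → S → (Fin d → ℝ))
    (ψ : (Fin d → ℝ) → Ω → ℝ) : Prop where
  measurable_scen : Measurable scen
  measurable_points : ∀ j, Measurable (U j)
  measurable_integrand : Measurable (Function.uncurry ψ)
  integrable_integrand : ∀ y, IntegrableOn (fun u => ψ u y) (unitCube d)
  uniform_points : ∀ j, P.map (U j) = volume.restrict (unitCube d)
  indep : IndepFun scen (fun s j => U j s) P

/-- The inner estimator `ĝ_m(y) = (1/m) ∑_{j=1}^m ψ(u_j; y)`, as a random variable. -/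
noncomputable def innerEst {S Ω : Type*} {d : ℕ} (U : ℕ → S → (Fin d → ℝ))
    (ψ : (Fin d → ℝ) → Ω → ℝ) (m : ℕ) (y : Ω) (s : S) : ℝ :=
  (1 / (m : ℝ)) * ∑ j ∈ Finset.range m, ψ (U j s) y

/-- The target `θ = P(g(ω) > c)`. -/
noncomputable def target {S Ω : Type*} [MeasurableSpace S] {d : ℕ} (P : Measure S)
    (scen : S → Ω) (ψ : (Fin d → ℝ) → Ω → ℝ) (c : ℝ) : ℝ :=
  P.real {s | c < condMean ψ (scen s)}

/-- The number `m_ℓ = 2^(ℓ + ℓ₀)` of inner samples at level `ℓ`. -/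
def innerSize (ℓ₀ ℓ : ℕ) : ℕ := 2 ^ (ℓ + ℓ₀)

/-- The scaled logistic sigmoid `S(x; k) = 1 / (1 + exp(-k x))`. -/
noncomputable def sigmoid (x k : ℝ) : ℝ := 1 / (1 + Real.exp (-(k * x)))

/-- The smoothed approximation `P̃_ℓ = S(ĝ_{m_ℓ}(ω) - c; k₀ r^ℓ)` of `𝟙{g(ω) > c}`. -/
noncomputable def smoothApprox {S Ω : Type*} {d : ℕ} (scen : S → Ω)
    (U : ℕ → S → (Fin d → ℝ)) (ψ : (Fin d → ℝ) → Ω → ℝ) (c k₀ r : ℝ) (ℓ₀ ℓ : ℕ) (s : S) : ℝ :=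
  sigmoid (innerEst U ψ (innerSize ℓ₀ ℓ) (scen s) s - c) (k₀ * r ^ ℓ)

/-- The corrections `Ỹ_0 = P̃_0` and `Ỹ_ℓ = P̃_ℓ - P̃_{ℓ-1}` for `ℓ ≥ 1`. Both terms use the same
scenario, and the coarse term uses the first half of the points of the fine one. -/
noncomputable def smoothDiff {S Ω : Type*} {d : ℕ} (scen : S → Ω)
    (U : ℕ → S → (Fin d → ℝ)) (ψ : (Fin d → ℝ) → Ω → ℝ) (c k₀ r : ℝ) (ℓ₀ : ℕ) :
    ℕ → S → ℝ
  | 0, s => smoothApprox scen U ψ c k₀ r ℓ₀ 0 s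
  | ℓ + 1, s => smoothApprox scen U ψ c k₀ r ℓ₀ (ℓ + 1) s - smoothApprox scen U ψ c k₀ r ℓ₀ ℓ s

/-- Inner variance condition of order `η`: `Var[ĝ_m(y)] ≤ σ²(y) / m^η` for every `m ≥ 1` and
every scenario `y`. -/
structure InnerVarianceBound {S Ω : Type*} [MeasurableSpace S] [MeasurableSpace Ω] {d : ℕ}
    (P : Measure S) (U : ℕ → S → (Fin d → ℝ)) (ψ : (Fin d → ℝ) → Ω → ℝ)
    (η : ℝ) (σsq : Ω → ℝ) : Prop where
  measurable : Measurable σsq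
  nonneg : ∀ y, 0 ≤ σsq y
  memLp : ∀ m : ℕ, 1 ≤ m → ∀ y, MemLp (innerEst U ψ m y) 2 P
  variance_le : ∀ m : ℕ, 1 ≤ m → ∀ y,
    variance (innerEst U ψ m y) P ≤ σsq y / (m : ℝ) ^ η

/-- The random variable `|g(ω) - c| / σ(ω)` has a density `ρ` with respect to Lebesgue measure,
and `ρ ≤ ρ₀` on some interval `[0, x₀]`. (As the quotient is set to `0` where `σ(ω) = 0`, the
existence of the density forces `σ(ω) > 0` almost surely, without which the quotient is not a
real random variable.) -/
def RatioDensityBound {S Ω : Type*} [MeasurableSpace S] {d : ℕ}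
    (P : Measure S) (scen : S → Ω) (ψ : (Fin d → ℝ) → Ω → ℝ) (c : ℝ) (σsq : Ω → ℝ) : Prop :=
  ∃ ρ : ℝ → ℝ≥0∞, Measurable ρ ∧
    P.map (fun s => |condMean ψ (scen s) - c| / Real.sqrt (σsq (scen s))) =
      volume.withDensity ρ ∧
    ∃ ρ₀ > (0 : ℝ), ∃ x₀ > (0 : ℝ), ∀ x ∈ Set.Icc 0 x₀, ρ x ≤ ENNReal.ofReal ρ₀

/-- On a common neighbourhood `(-δ₀, δ₀)` of the origin the random variables `ĝ_{m_ℓ}(ω) - c`,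
`ℓ = 0, 1, …`, have densities `π_ℓ`, and these are bounded by one constant `C`. -/
def InnerDensityBound {S Ω : Type*} [MeasurableSpace S] {d : ℕ}
    (P : Measure S) (scen : S → Ω) (U : ℕ → S → (Fin d → ℝ)) (ψ : (Fin d → ℝ) → Ω → ℝ)
    (c : ℝ) (ℓ₀ : ℕ) : Prop :=
  ∃ δ₀ > (0 : ℝ), ∃ C : ℝ, ∃ π : ℕ → ℝ → ℝ≥0∞, ∀ ℓ, Measurable (π ℓ) ∧
    (P.map (fun s => innerEst U ψ (innerSize ℓ₀ ℓ) (scen s) s - c)).restrict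
        (Set.Ioo (-δ₀) δ₀) =
      (volume.restrict (Set.Ioo (-δ₀) δ₀)).withDensity (π ℓ) ∧
    ∀ x ∈ Set.Ioo (-δ₀) δ₀, π ℓ x ≤ ENNReal.ofReal C

/-- `Yrep ℓ i`, `i = 0, 1, …`, are iid replications of `Y ℓ`, independent across levels `ℓ`. -/
structure IsReplication {S S' : Type*} [MeasurableSpace S] [MeasurableSpace S']
    (P : Measure S) (Y : ℕ → S → ℝ) (Q : Measure S') (Yrep : ℕ → ℕ → S' → ℝ) : Prop where
  identDistrib : ∀ ℓ i, IdentDistrib (Yrep ℓ i) (Y ℓ) Q P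
  indep : iIndepFun (fun p : ℕ × ℕ => Yrep p.1 p.2) Q

/-- The multilevel estimator `∑_{ℓ=0}^L (1/N_ℓ) ∑_{i=1}^{N_ℓ} Y_ℓ^{(i)}`. -/
noncomputable def mlmcEstimator {S' : Type*} (Yrep : ℕ → ℕ → S' → ℝ) (L : ℕ) (N : ℕ → ℕ)
    (s : S') : ℝ :=
  ∑ ℓ ∈ Finset.range (L + 1), (1 / (N ℓ : ℝ)) * ∑ i ∈ Finset.range (N ℓ), Yrep ℓ i s

/-- Unit costs of the primitive operations: `scenario` for drawing one scenario, `inner` for one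
inner sample (producing one point `u_j`, evaluating `ψ(u_j; y)` and adding it up), and `output`
for the remaining work per sample of `Ỹ_ℓ` (the divisions, at most two evaluations of the
sigmoid, their difference, and adding it up). -/
structure UnitCosts where
  scenario : ℝ≥0
  inner : ℝ≥0
  output : ℝ≥0

/-- The cost `C̃_ℓ` of one sample of `Ỹ_ℓ`: one scenario, `m_ℓ` inner samples (the coarse
estimate reuses the first half of them), and the final operations. -/
noncomputable def sampleCost (κ : UnitCosts) (ℓ₀ ℓ : ℕ) : ℝ :=
  κ.scenario + (innerSize ℓ₀ ℓ : ℝ) * κ.inner + κ.output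

/-- The total cost `∑_{ℓ=0}^L N_ℓ C̃_ℓ` of the multilevel estimator. -/
noncomputable def totalCost (κ : UnitCosts) (ℓ₀ L : ℕ) (N : ℕ → ℕ) : ℝ :=
  ∑ ℓ ∈ Finset.range (L + 1), (N ℓ : ℝ) * sampleCost κ ℓ₀ ℓ

end NestedMLMC

namespace NestedMLMC

/-! Everything rests on one estimate: the smoothed approximation at level `ℓ` is within `O(2^(-ℓ))`
of the indicator of `g(ω) > c` in mean square. The error has two sources. Smoothing: the sigmoid
differs from the indicator of `ĝ > c` noticeably only when `|ĝ - c|` is of order `2^(-ℓ)`, which has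
probability `O(2^(-ℓ))` by the density bound on `ĝ - c`. Misclassification: `ĝ` and `g` lie on
different sides of `c` only if `|ĝ - g| ≥ |g - c|`; given the scenario, Chebyshev makes this
unlikely once `m |g - c| / σ` is large, and the density bound on the ratio gives `O(1/m)`. Both
sources are dominated by the kernel `1 / (1 + (k x)²)`, whose integral is `π / k`, so
`lintegral_inv_one_add_mul_sq_le` serves both.

By Jensen the squared bias at the last level is `O(2^(-L))`, and by the triangle inequality the
variances of the corrections are `O(2^(-ℓ))`. Since a sample costs `O(2^ℓ)`, every level needs
comparable work; the `O(log(1/ε))` levels then cost `ε^(-2) (log ε)²` in total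
(`exists_level_sampleSizes`). -/

lemma lintegral_inv_one_add_mul_sq {k : ℝ} (hk : 0 < k) :
    ∫⁻ x : ℝ, ENNReal.ofReal (1 + (k * x) ^ 2)⁻¹ = ENNReal.ofReal (Real.pi / k) := by
  rw [← ofReal_integral_eq_lintegral_ofReal
    (integrable_inv_one_add_sq.comp_mul_left' hk.ne')
    (Filter.Eventually.of_forall fun x => by positivity)]
  have := Measure.integral_comp_mul_left (fun x : ℝ => (1 + x ^ 2)⁻¹) k
  rw [this, integral_univ_inv_one_add_sq, abs_of_pos (by positivity), smul_eq_mul]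
  congr 1
  field_simp

/-- If a probability law on `ℝ` has density at most `C` on `A` and lives outside `(-δ, δ)` off `A`,
then the mean of `1 / (1 + (k x)²)` is `O(1 / k)`. -/
lemma lintegral_inv_one_add_mul_sq_le (μ : Measure ℝ) [IsProbabilityMeasure μ] {A : Set ℝ}
    (hA : MeasurableSet A) {C δ : ℝ} (hC : 0 ≤ C) (hδ : 0 < δ)
    (hdens : μ.restrict A ≤ ENNReal.ofReal C • volume)
    (hout : ∀ᵐ x ∂μ.restrict Aᶜ, δ ≤ |x|) {k : ℝ} (hk : 0 < k) :
    ∫⁻ x, ENNReal.ofReal (1 + (k * x) ^ 2)⁻¹ ∂μ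
      ≤ ENNReal.ofReal ((C * Real.pi + 1 / (2 * δ)) / k) := by
  have hin : ∫⁻ x in A, ENNReal.ofReal (1 + (k * x) ^ 2)⁻¹ ∂μ
      ≤ ENNReal.ofReal (C * (Real.pi / k)) := by
    refine (lintegral_mono' hdens le_rfl).trans ?_
    rw [lintegral_smul_measure, lintegral_inv_one_add_mul_sq hk, smul_eq_mul,
      ENNReal.ofReal_mul hC]
  -- Using `1 + t² ≥ 2t` instead of `1 + t² ≥ t²` gives a tail of order `1 / k` for every `k > 0`,
  -- not only for large `k`.
  have hfar : ∫⁻ x in Aᶜ, ENNReal.ofReal (1 + (k * x) ^ 2)⁻¹ ∂μ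
      ≤ ENNReal.ofReal (1 / (2 * δ * k)) := by
    calc ∫⁻ x in Aᶜ, ENNReal.ofReal (1 + (k * x) ^ 2)⁻¹ ∂μ
        ≤ ∫⁻ _ in Aᶜ, ENNReal.ofReal (1 / (2 * δ * k)) ∂μ := by
          refine lintegral_mono_ae (hout.mono fun x hx => ENNReal.ofReal_le_ofReal ?_)
          rw [← one_div]
          refine one_div_le_one_div_of_le (by positivity) ?_
          have h1 : δ * k ≤ k * |x| := by nlinarith
          have h2 : (k * x) ^ 2 = (k * |x|) ^ 2 := by rw [mul_pow, mul_pow, sq_abs]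
          nlinarith [sq_nonneg (k * |x| - 1)]
      _ ≤ ENNReal.ofReal (1 / (2 * δ * k)) := by
          rw [lintegral_const]
          exact mul_le_of_le_one_right' ((Measure.restrict_apply_le _ _).trans prob_le_one)
  rw [← lintegral_add_compl _ hA]
  refine (add_le_add hin hfar).trans ?_
  rw [← ENNReal.ofReal_add (by positivity) (by positivity)]
  refine ENNReal.ofReal_le_ofReal (le_of_eq ?_)
  field_simp

/-! ### Sigmoid against indicator. -/

lemma exp_neg_sq_le {t : ℝ} (ht : 0 ≤ t) : Real.exp (-t) ^ 2 ≤ (1 + t ^ 2)⁻¹ := by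
  rw [← Real.exp_nat_mul, show ((2 : ℕ) : ℝ) * -t = -(2 * t) by push_cast; ring, Real.exp_neg]
  refine inv_anti₀ (by positivity) ?_
  nlinarith [Real.quadratic_le_exp_of_nonneg (show 0 ≤ 2 * t by positivity)]

lemma sigmoid_nonneg (x k : ℝ) : 0 ≤ sigmoid x k := by
  unfold sigmoid; positivity

lemma sigmoid_le_one (x k : ℝ) : sigmoid x k ≤ 1 := by
  unfold sigmoid
  rw [div_le_one (by positivity)]
  linarith [Real.exp_pos (-(k * x))]

lemma measurable_sigmoid (k : ℝ) : Measurable fun x => sigmoid x k := by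
  unfold sigmoid; fun_prop

/-- On either side of the origin the error is at most `exp (-k |x|)`; the square of this is weakened
to the kernel shared with the Chebyshev bound. -/
lemma sigmoid_sub_indicator_sq_le (x : ℝ) {k : ℝ} (hk : 0 < k) :
    (sigmoid x k - if 0 < x then 1 else 0) ^ 2 ≤ (1 + (k * x) ^ 2)⁻¹ := by
  split_ifs with hx
  · refine le_trans ?_ (exp_neg_sq_le (mul_pos hk hx).le)
    rw [sub_sq_comm]
    refine pow_le_pow_left₀ (by linarith [sigmoid_le_one x k]) ?_ 2
    have he := Real.exp_pos (-(k * x))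
    rw [sigmoid, sub_le_iff_le_add, ← sub_le_iff_le_add', le_div_iff₀ (by positivity)]
    nlinarith
  · have ht : 0 ≤ -(k * x) := by nlinarith
    rw [show (k * x) ^ 2 = (-(k * x)) ^ 2 by ring]
    refine le_trans ?_ (exp_neg_sq_le ht)
    rw [sub_zero]
    refine pow_le_pow_left₀ (sigmoid_nonneg x k) ?_ 2
    rw [sigmoid, Real.exp_neg (-(k * x)), ← one_div]
    exact one_div_le_one_div_of_le (Real.exp_pos _) (by linarith)

/-! ### Choice of levels and sample sizes. -/

/-- Choice of the number of levels and of the sample sizes when the variance decays like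
`2^(-ℓ)` and the cost grows like `2^ℓ`. -/
lemma exists_level_sampleSizes {B K : ℝ} (hB : 1 ≤ B) (hK : 0 ≤ K) (cost : ℕ → ℝ)
    (hcost : ∀ ℓ, cost ℓ ≤ K * 2 ^ ℓ) :
    ∃ c : ℝ, 0 < c ∧ ∀ ε : ℝ, 0 < ε → ε < 1 / Real.exp 1 →
      ∃ (L : ℕ) (N : ℕ → ℕ), (∀ ℓ, 1 ≤ N ℓ) ∧ B / 2 ^ L ≤ ε ^ 2 / 2 ∧
        ∑ ℓ ∈ Finset.range (L + 1), B / 2 ^ ℓ / (N ℓ : ℝ) ≤ ε ^ 2 / 2 ∧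
        ∑ ℓ ∈ Finset.range (L + 1), (N ℓ : ℝ) * cost ℓ
          ≤ c * (ε ^ (-2 : ℤ) * Real.log ε ^ 2) := by
  -- Chosen so that the number of levels is at most `M * -log ε`: `2^n ≤ 2B / ε²` bounds `n log 2`
  -- by `log (2B) - 2 log ε`, and `-log ε ≥ 1` absorbs the additive constants.
  set M : ℝ := (Real.log (2 * B) + 2) / Real.log 2 + 2 with hM
  have hlog2 : 0 < Real.log 2 := Real.log_pos one_lt_two
  -- The `+ 1` only keeps the constant positive when `K = 0`.
  refine ⟨6 * K * B * M ^ 2 + 1, by positivity, fun ε hε hε' => ?_⟩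
  have hlog : 1 ≤ -Real.log ε := by
    have := Real.log_lt_log hε hε'
    rw [one_div, Real.log_inv, Real.log_exp] at this
    linarith
  have hε1 : ε ^ 2 ≤ 1 := by
    refine pow_le_one₀ hε.le (hε'.le.trans ?_)
    rw [div_le_one (Real.exp_pos 1)]
    exact Real.one_le_exp zero_le_one
  have hx : 1 ≤ 2 * B / ε ^ 2 := by
    rw [le_div_iff₀ (by positivity)]; linarith
  obtain ⟨n, hn1, hn2⟩ := exists_nat_pow_near hx one_lt_two
  have hnM : (n : ℝ) + 2 ≤ M * -Real.log ε := by
    have h := Real.log_le_log (by positivity) hn1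
    rw [Real.log_pow, Real.log_div (by positivity) (by positivity), Real.log_pow] at h
    push_cast at h
    have h0 : 0 ≤ Real.log (2 * B) := Real.log_nonneg (by linarith)
    have h1 : (n : ℝ) ≤ (Real.log (2 * B) + 2) / Real.log 2 * -Real.log ε := by
      rw [div_mul_eq_mul_div, le_div_iff₀ hlog2]
      nlinarith
    rw [hM]; nlinarith
  -- With `N ℓ ≈ T / 2^ℓ`, each of the `n + 2` levels contributes at most `B / T`, an equal share of
  -- the variance budget `ε² / 2`.
  set T : ℝ := 2 * B * ((n : ℝ) + 2) / ε ^ 2 with hT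
  have hTpos : 0 < T := by positivity
  have hL : ((n + 1 + 1 : ℕ) : ℝ) = n + 2 := by push_cast; ring
  have hNle : ∀ ℓ : ℕ, T / 2 ^ ℓ ≤ (⌈T / 2 ^ ℓ⌉₊ : ℝ) := fun ℓ => Nat.le_ceil _
  refine ⟨n + 1, fun ℓ => ⌈T / 2 ^ ℓ⌉₊, fun ℓ => Nat.one_le_ceil_iff.2 (by positivity), ?_, ?_, ?_⟩
  · rw [div_lt_iff₀ (by positivity)] at hn2
    rw [div_le_iff₀ (by positivity)]
    linarith
  · have hterm : ∀ ℓ ∈ Finset.range (n + 1 + 1),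
        B / 2 ^ ℓ / (⌈T / 2 ^ ℓ⌉₊ : ℝ) ≤ ε ^ 2 / (2 * ((n : ℝ) + 2)) := fun ℓ _ => by
      have hp : 0 < T / 2 ^ ℓ := by positivity
      calc B / 2 ^ ℓ / (⌈T / 2 ^ ℓ⌉₊ : ℝ) ≤ B / 2 ^ ℓ / (T / 2 ^ ℓ) :=
            div_le_div_of_nonneg_left (by positivity) hp (hNle ℓ)
        _ = ε ^ 2 / (2 * ((n : ℝ) + 2)) := by rw [hT]; field_simp
    refine (Finset.sum_le_card_nsmul _ _ _ hterm).trans (le_of_eq ?_)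
    rw [Finset.card_range, nsmul_eq_mul, hL]
    field_simp
  · have hterm : ∀ ℓ ∈ Finset.range (n + 1 + 1),
        (⌈T / 2 ^ ℓ⌉₊ : ℝ) * cost ℓ ≤ 6 * K * B * ((n : ℝ) + 2) / ε ^ 2 := fun ℓ hℓ => by
      have h2 : (2 : ℝ) ^ ℓ ≤ 2 ^ (n + 1) :=
        pow_le_pow_right₀ one_le_two (Nat.lt_succ_iff.1 (Finset.mem_range.1 hℓ))
      -- Rounding `N ℓ` up costs at most `K * 2^ℓ` extra; this is at most `2 * K * T`, so a level
      -- costs at most `3 * K * T`.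
      have h3 : (2 : ℝ) ^ (n + 1) ≤ 4 * B * ((n : ℝ) + 2) / ε ^ 2 := by
        have h4 : 2 * (2 * B / ε ^ 2) ≤ 4 * B * ((n : ℝ) + 2) / ε ^ 2 := by
          rw [← mul_div_assoc]
          refine div_le_div_of_nonneg_right ?_ (by positivity)
          have : (0 : ℝ) ≤ n := n.cast_nonneg
          nlinarith
        rw [pow_succ]; linarith
      calc (⌈T / 2 ^ ℓ⌉₊ : ℝ) * cost ℓ ≤ (T / 2 ^ ℓ + 1) * (K * 2 ^ ℓ) :=
            (mul_le_mul_of_nonneg_left (hcost ℓ) (Nat.cast_nonneg _)).trans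
              (mul_le_mul_of_nonneg_right (Nat.ceil_lt_add_one (by positivity)).le
                (by positivity))
        _ = K * (T + 2 ^ ℓ) := by field_simp
        _ ≤ K * (T + 4 * B * ((n : ℝ) + 2) / ε ^ 2) := by gcongr; linarith
        _ = _ := by rw [hT]; ring
    refine (Finset.sum_le_card_nsmul _ _ _ hterm).trans ?_
    rw [Finset.card_range, nsmul_eq_mul, hL, zpow_neg,
      show ε ^ (2 : ℤ) = ε ^ 2 by norm_cast]
    have hsq : ((n : ℝ) + 2) ^ 2 ≤ M ^ 2 * Real.log ε ^ 2 := by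
      rw [← mul_pow, ← neg_sq (M * Real.log ε), ← mul_neg]
      exact pow_le_pow_left₀ (by positivity) hnM 2
    calc ((n : ℝ) + 2) * (6 * K * B * ((n : ℝ) + 2) / ε ^ 2)
        = 6 * K * B * (ε ^ 2)⁻¹ * ((n : ℝ) + 2) ^ 2 := by ring
      _ ≤ 6 * K * B * (ε ^ 2)⁻¹ * (M ^ 2 * Real.log ε ^ 2) := by gcongr
      _ = 6 * K * B * M ^ 2 * ((ε ^ 2)⁻¹ * Real.log ε ^ 2) := by ring
      _ ≤ _ := by gcongr; linarith

/-! ### Mean and variance of the multilevel estimator. -/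

section Estimator

/-- Flattening to one sum over pairs lets independence within and across levels be used in a single
step. -/
lemma mlmcEstimator_eq_sum_sigma {S' : Type*} (Yrep : ℕ → ℕ → S' → ℝ) (L : ℕ) (N : ℕ → ℕ) :
    mlmcEstimator Yrep L N =
      ∑ p ∈ (Finset.range (L + 1)).sigma (fun ℓ => Finset.range (N ℓ)),
        (1 / (N p.1 : ℝ)) • Yrep p.1 p.2 := by
  ext s
  simp [mlmcEstimator, Finset.sum_sigma, Finset.mul_sum]

variable {S S' : Type*} [MeasurableSpace S] [MeasurableSpace S'] {P : Measure S} {Q : Measure S'}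
  {Y : ℕ → S → ℝ} {Yrep : ℕ → ℕ → S' → ℝ}

lemma IsReplication.memLp (h : IsReplication P Y Q Yrep) (hY : ∀ ℓ, MemLp (Y ℓ) 2 P) (ℓ i : ℕ) :
    MemLp (Yrep ℓ i) 2 Q :=
  (h.identDistrib ℓ i).symm.memLp_snd (hY ℓ)

lemma IsReplication.memLp_mlmcEstimator (h : IsReplication P Y Q Yrep)
    (hY : ∀ ℓ, MemLp (Y ℓ) 2 P) (L : ℕ) (N : ℕ → ℕ) : MemLp (mlmcEstimator Yrep L N) 2 Q := by
  rw [mlmcEstimator_eq_sum_sigma]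
  exact memLp_finsetSum' _ fun p _ => (h.memLp hY p.1 p.2).const_smul _

lemma IsReplication.integral_mlmcEstimator [IsProbabilityMeasure Q]
    (h : IsReplication P Y Q Yrep)
    (hY : ∀ ℓ, MemLp (Y ℓ) 2 P) (L : ℕ) {N : ℕ → ℕ} (hN : ∀ ℓ, 1 ≤ N ℓ) :
    ∫ s, mlmcEstimator Yrep L N s ∂Q = ∑ ℓ ∈ Finset.range (L + 1), ∫ s, Y ℓ s ∂P := by
  have hint : ∀ ℓ i, Integrable (Yrep ℓ i) Q := fun ℓ i =>
    (h.memLp hY ℓ i).integrable one_le_two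
  unfold mlmcEstimator
  rw [integral_finsetSum _ fun ℓ _ => (integrable_finsetSum _ fun i _ => hint ℓ i).const_mul _]
  refine Finset.sum_congr rfl fun ℓ _ => ?_
  have hpos : (N ℓ : ℝ) ≠ 0 := by exact_mod_cast (Nat.one_le_iff_ne_zero.1 (hN ℓ))
  rw [integral_const_mul, integral_finsetSum _ fun i _ => hint ℓ i,
    Finset.sum_congr rfl fun i _ => (h.identDistrib ℓ i).integral_eq]
  simp [hpos]

lemma IsReplication.variance_mlmcEstimator (h : IsReplication P Y Q Yrep)
    (hY : ∀ ℓ, MemLp (Y ℓ) 2 P) (L : ℕ) {N : ℕ → ℕ} (hN : ∀ ℓ, 1 ≤ N ℓ) :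
    Var[mlmcEstimator Yrep L N; Q] =
      ∑ ℓ ∈ Finset.range (L + 1), Var[Y ℓ; P] / (N ℓ : ℝ) := by
  rw [mlmcEstimator_eq_sum_sigma, IndepFun.variance_sum
    (fun p _ => (h.memLp hY p.1 p.2).const_smul _), Finset.sum_sigma]
  · refine Finset.sum_congr rfl fun ℓ _ => ?_
    have hpos : (N ℓ : ℝ) ≠ 0 := by exact_mod_cast (Nat.one_le_iff_ne_zero.1 (hN ℓ))
    simp only [variance_smul, (h.identDistrib ℓ _).variance_eq]
    rw [Finset.sum_const, Finset.card_range, nsmul_eq_mul]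
    field_simp
  · intro p _ q _ hpq
    have hne : (p.1, p.2) ≠ (q.1, q.2) := fun he => hpq <| by
      cases p; cases q; simp_all
    exact (h.indep.indepFun hne).comp (φ := fun x => (1 / (N p.1 : ℝ)) • x)
      (ψ := fun x => (1 / (N q.1 : ℝ)) • x) (by fun_prop) (by fun_prop)

lemma integral_sub_const_sq [IsProbabilityMeasure Q] {X : S' → ℝ} (hX : MemLp X 2 Q) (t : ℝ) :
    ∫ s, (X s - t) ^ 2 ∂Q = Var[X; Q] + (∫ s, X s ∂Q - t) ^ 2 := by
  have hi := hX.integrable one_le_two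
  have := variance_eq_sub (hX.sub (memLp_const t))
  change Var[fun s => X s - t; Q] = _ at this
  rw [variance_sub_const hX.aestronglyMeasurable] at this
  have h2 : ∫ s, (X - fun _ : S' => t) s ∂Q = ∫ s, X s ∂Q - t := by
    simp [integral_sub hi (integrable_const t)]
  rw [h2] at this
  simp only [Pi.pow_apply, Pi.sub_apply] at this
  linarith

/-- Bias–variance decomposition of the mean squared error of the multilevel estimator. -/
lemma IsReplication.integral_mlmcEstimator_sub_sq [IsProbabilityMeasure Q]
    (h : IsReplication P Y Q Yrep)
    (hY : ∀ ℓ, MemLp (Y ℓ) 2 P) (L : ℕ) {N : ℕ → ℕ} (hN : ∀ ℓ, 1 ≤ N ℓ) (t : ℝ) :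
    ∫ s, (mlmcEstimator Yrep L N s - t) ^ 2 ∂Q =
      ∑ ℓ ∈ Finset.range (L + 1), Var[Y ℓ; P] / (N ℓ : ℝ) +
        (∑ ℓ ∈ Finset.range (L + 1), ∫ s, Y ℓ s ∂P - t) ^ 2 := by
  rw [integral_sub_const_sq (h.memLp_mlmcEstimator hY L N), h.variance_mlmcEstimator hY L hN,
    h.integral_mlmcEstimator hY L hN]

end Estimator

/-! ### Mean-square error of the smoothed approximations. -/

section Nested

variable {S Ω : Type*} [MeasurableSpace S] [MeasurableSpace Ω] {d : ℕ} {P : Measure S}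
  {scen : S → Ω} {U : ℕ → S → (Fin d → ℝ)} {ψ : (Fin d → ℝ) → Ω → ℝ}

lemma IsNestedSimulation.measurable_pointSeq (h : IsNestedSimulation P scen U ψ) :
    Measurable fun s j => U j s :=
  measurable_pi_lambda _ h.measurable_points

lemma IsNestedSimulation.measurable_average (h : IsNestedSimulation P scen U ψ) (m : ℕ) :
    Measurable fun p : Ω × (ℕ → Fin d → ℝ) =>
      (1 / (m : ℝ)) * ∑ j ∈ Finset.range m, ψ (p.2 j) p.1 := by
  refine (Finset.measurable_fun_sum _ fun j _ => ?_).const_mul _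
  have hj : Measurable fun p : Ω × (ℕ → Fin d → ℝ) => (p.2 j, p.1) := by fun_prop
  exact h.measurable_integrand.comp hj

lemma IsNestedSimulation.measurable_innerEst (h : IsNestedSimulation P scen U ψ) (m : ℕ) :
    Measurable fun s => innerEst U ψ m (scen s) s :=
  (h.measurable_average m).comp (h.measurable_scen.prodMk h.measurable_pointSeq)

lemma IsNestedSimulation.measurable_condMean (h : IsNestedSimulation P scen U ψ) :
    Measurable (condMean ψ) := by
  have : Measurable (Function.uncurry fun (y : Ω) (u : Fin d → ℝ) => ψ u y) :=
    h.measurable_integrand.comp measurable_swap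
  exact (this.stronglyMeasurable.integral_prod_right
    (ν := volume.restrict (unitCube d))).measurable

/-- Unbiasedness needs only the uniform marginals, so dependence between the points is harmless. -/
lemma IsNestedSimulation.integral_innerEst (h : IsNestedSimulation P scen U ψ) {m : ℕ}
    (hm : 1 ≤ m) (y : Ω) : ∫ s, innerEst U ψ m y s ∂P = condMean ψ y := by
  have hmeas : Measurable fun u => ψ u y :=
    h.measurable_integrand.comp (measurable_id.prodMk measurable_const)
  have hint : ∀ j, Integrable (fun s => ψ (U j s) y) P := fun j => by
    have := h.integrable_integrand y
    rw [IntegrableOn, ← h.uniform_points j] at this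
    exact this.comp_measurable (h.measurable_points j)
  have hval : ∀ j, ∫ s, ψ (U j s) y ∂P = condMean ψ y := fun j => by
    rw [condMean, ← h.uniform_points j, integral_map (h.measurable_points j).aemeasurable
      hmeas.aestronglyMeasurable]
  have hpos : (m : ℝ) ≠ 0 := by exact_mod_cast (Nat.one_le_iff_ne_zero.1 hm)
  unfold innerEst
  rw [integral_const_mul, integral_finsetSum _ fun j _ => hint j,
    Finset.sum_congr rfl fun j _ => hval j]
  simp [hpos]

/-- Conditioning on the scenario, which is independent of the points. -/
lemma IsNestedSimulation.lintegral_eq [IsProbabilityMeasure P] (h : IsNestedSimulation P scen U ψ)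
    {f : Ω × (ℕ → Fin d → ℝ) → ℝ≥0∞} (hf : Measurable f) :
    ∫⁻ s, f (scen s, fun j => U j s) ∂P =
      ∫⁻ s, ∫⁻ t, f (scen s, fun j => U j t) ∂P ∂P := by
  have hU := h.measurable_pointSeq
  have hmap := (indepFun_iff_map_prod_eq_prod_map_map h.measurable_scen.aemeasurable
    hU.aemeasurable).1 h.indep
  rw [← lintegral_map hf (h.measurable_scen.prodMk hU), hmap, lintegral_prod _ hf.aemeasurable,
    lintegral_map hf.lintegral_prod_right' h.measurable_scen]
  exact lintegral_congr fun s => lintegral_map (hf.comp measurable_prodMk_left) hU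

variable {σsq : Ω → ℝ} {c : ℝ}

/-- Chebyshev's inequality for the event that the inner error exceeds the distance of `g(y)`
to the threshold. -/
lemma InnerVarianceBound.measure_le_abs_sub_le [IsProbabilityMeasure P]
    (hvar : InnerVarianceBound P U ψ 2 σsq) (h : IsNestedSimulation P scen U ψ)
    {m : ℕ} (hm : 1 ≤ m) (y : Ω) :
    P {s | |condMean ψ y - c| ≤ |innerEst U ψ m y s - condMean ψ y|} ≤
      ENNReal.ofReal 2 *
        ENNReal.ofReal (1 + (m * (|condMean ψ y - c| / Real.sqrt (σsq y))) ^ 2)⁻¹ := by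
  have hmpos : (0 : ℝ) < m := by exact_mod_cast hm
  rw [← ENNReal.ofReal_mul zero_le_two]
  set t := |condMean ψ y - c| with ht
  set q := m * (t / Real.sqrt (σsq y)) with hq
  have hq0 : 0 ≤ q := by positivity
  -- For `q² ≤ 1` the bound `2 / (1 + q²)` is at least `1`. Otherwise Chebyshev gives `1 / q² ≤ 2 /
  -- (1 + q²)`; here `σ` and `t` are nonzero, as either being zero (with division by zero equal to
  -- zero) would give `q = 0`.
  rcases le_or_gt (q ^ 2) 1 with hq1 | hq1
  · refine prob_le_one.trans ?_
    rw [← ENNReal.ofReal_one]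
    refine ENNReal.ofReal_le_ofReal ?_
    rw [← div_eq_mul_inv, le_div_iff₀ (by positivity)]
    linarith
  · have hqne : q ≠ 0 := fun h0 => by rw [h0] at hq1; norm_num at hq1
    have hσ : 0 < Real.sqrt (σsq y) := (Real.sqrt_nonneg _).lt_of_ne fun h0 => hqne <| by
      rw [hq, ← h0]; simp
    have htpos : 0 < t := (abs_nonneg _).lt_of_ne fun h0 => hqne <| by
      rw [hq, ht, ← h0]; simp
    have hch := meas_ge_le_variance_div_sq (hvar.memLp m hm y) htpos
    rw [h.integral_innerEst hm y] at hch
    refine hch.trans (ENNReal.ofReal_le_ofReal ?_)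
    have hv := hvar.variance_le m hm y
    rw [Real.rpow_two] at hv
    calc Var[innerEst U ψ m y; P] / t ^ 2 ≤ σsq y / (m : ℝ) ^ 2 / t ^ 2 := by gcongr
      _ = (q ^ 2)⁻¹ := by
        have := Real.sq_sqrt (hvar.nonneg y)
        rw [hq, mul_pow, div_pow, this]
        have : 0 < σsq y := Real.sqrt_pos.1 hσ
        field_simp
      _ ≤ 2 * (1 + q ^ 2)⁻¹ := by
        rw [← div_eq_mul_inv, ← one_div, div_le_div_iff₀ (by positivity) (by positivity)]
        linarith

lemma exists_lintegral_ratio_le [IsProbabilityMeasure P]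
    (h : IsNestedSimulation P scen U ψ) (hσ : Measurable σsq)
    (hratio : RatioDensityBound P scen ψ c σsq) :
    ∃ K : ℝ, 0 ≤ K ∧ ∀ k : ℝ, 0 < k →
      ∫⁻ s, ENNReal.ofReal
        (1 + (k * (|condMean ψ (scen s) - c| / Real.sqrt (σsq (scen s)))) ^ 2)⁻¹ ∂P
      ≤ ENNReal.ofReal (K / k) := by
  obtain ⟨ρ, hρ, hmap, ρ₀, hρ₀, x₀, hx₀, hbd⟩ := hratio
  have hX : Measurable fun s => |condMean ψ (scen s) - c| / Real.sqrt (σsq (scen s)) := by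
    have h1 := h.measurable_condMean.comp h.measurable_scen
    have h2 := hσ.comp h.measurable_scen
    have h3 : Measurable fun s => |condMean ψ (scen s) - c| := (h1.sub_const c).abs
    exact h3.div h2.sqrt
  have hprob := Measure.isProbabilityMeasure_map (μ := P) hX.aemeasurable
  refine ⟨ρ₀ * Real.pi + 1 / (2 * x₀), by positivity, fun k hk => ?_⟩
  have hf : Measurable fun x : ℝ => ENNReal.ofReal (1 + (k * x) ^ 2)⁻¹ := by fun_prop
  rw [← lintegral_map hf hX]
  refine lintegral_inv_one_add_mul_sq_le _ (measurableSet_Icc (a := 0) (b := x₀)) hρ₀.le hx₀ ?_ ?_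
    hk
  · rw [hmap, restrict_withDensity measurableSet_Icc]
    refine Measure.le_iff.2 fun s hs => ?_
    rw [withDensity_apply _ hs, Measure.restrict_restrict hs, Measure.smul_apply, smul_eq_mul]
    calc ∫⁻ x in s ∩ Set.Icc 0 x₀, ρ x ≤ ∫⁻ _ in s ∩ Set.Icc 0 x₀, ENNReal.ofReal ρ₀ :=
          setLIntegral_mono' (hs.inter measurableSet_Icc) fun x hx => hbd x hx.2
      _ ≤ ENNReal.ofReal ρ₀ * volume s := by
          rw [setLIntegral_const]
          gcongr
          exact Set.inter_subset_left
  -- The ratio is nonnegative, so outside `[0, x₀]` it exceeds `x₀`.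
  · have hnn : ∀ᵐ x ∂P.map fun s => |condMean ψ (scen s) - c| / Real.sqrt (σsq (scen s)),
        0 ≤ x :=
      (ae_map_iff hX.aemeasurable measurableSet_Ici).2
        (Filter.Eventually.of_forall fun s => by positivity)
    filter_upwards [ae_restrict_of_ae hnn, ae_restrict_mem measurableSet_Icc.compl] with x h0 h1
    rw [abs_of_nonneg h0]
    by_contra hlt
    exact h1 ⟨h0, (not_le.1 hlt).le⟩

lemma exists_lintegral_innerEst_le [IsProbabilityMeasure P] {ℓ₀ : ℕ}
    (h : IsNestedSimulation P scen U ψ) (hdens : InnerDensityBound P scen U ψ c ℓ₀) :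
    ∃ K : ℝ, 0 ≤ K ∧ ∀ (ℓ : ℕ) (k : ℝ), 0 < k →
      ∫⁻ s, ENNReal.ofReal
        (1 + (k * (innerEst U ψ (innerSize ℓ₀ ℓ) (scen s) s - c)) ^ 2)⁻¹ ∂P
      ≤ ENNReal.ofReal (K / k) := by
  obtain ⟨δ, hδ, C, π, hπ⟩ := hdens
  -- The constant does not depend on `ℓ` because the density bound is uniform in `ℓ`; `max C 0`
  -- covers a negative `C`, for which `ENNReal.ofReal C` is zero.
  refine ⟨max C 0 * Real.pi + 1 / (2 * δ), by positivity, fun ℓ k hk => ?_⟩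
  obtain ⟨_, hmap, hbd⟩ := hπ ℓ
  have hX : Measurable fun s => innerEst U ψ (innerSize ℓ₀ ℓ) (scen s) s - c :=
    (h.measurable_innerEst _).sub_const c
  have hprob := Measure.isProbabilityMeasure_map (μ := P) hX.aemeasurable
  have hf : Measurable fun x : ℝ => ENNReal.ofReal (1 + (k * x) ^ 2)⁻¹ := by fun_prop
  rw [← lintegral_map hf hX]
  refine lintegral_inv_one_add_mul_sq_le _ (measurableSet_Ioo (a := -δ) (b := δ))
    (le_max_right C 0) hδ ?_ ?_ hk
  · rw [hmap]
    refine Measure.le_iff.2 fun s hs => ?_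
    rw [withDensity_apply _ hs, Measure.restrict_restrict hs, Measure.smul_apply, smul_eq_mul]
    calc ∫⁻ x in s ∩ Set.Ioo (-δ) δ, π ℓ x
        ≤ ∫⁻ _ in s ∩ Set.Ioo (-δ) δ, ENNReal.ofReal (max C 0) :=
          setLIntegral_mono' (hs.inter measurableSet_Ioo) fun x hx =>
            (hbd x hx.2).trans (ENNReal.ofReal_le_ofReal (le_max_left C 0))
      _ ≤ ENNReal.ofReal (max C 0) * volume s := by
          rw [setLIntegral_const]
          gcongr
          exact Set.inter_subset_left
  · filter_upwards [ae_restrict_mem measurableSet_Ioo.compl] with x hx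
    by_contra hlt
    exact hx (abs_lt.1 (not_le.1 hlt))

/-- If the indicators differ, the origin separates `a` from `b`, so their distance is at least
`|b|`. The inequality cannot be strict: take `a = 0 < b`. -/
lemma ite_pos_sub_ite_pos_sq_le (a b : ℝ) :
    ((if 0 < a then (1 : ℝ) else 0) - if 0 < b then 1 else 0) ^ 2
      ≤ if |b| ≤ |a - b| then 1 else 0 := by
  split_ifs with ha hb hab hab hb hab hab <;> norm_num
  · exact hab (by rw [abs_of_nonpos (not_lt.1 hb), abs_of_pos (by linarith)]; linarith)
  · exact hab (by rw [abs_of_pos hb, abs_of_neg (by linarith)]; linarith)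

/-- The smoothed approximations converge to the indicator in mean square at rate `2^(-ℓ)`. -/
lemma exists_integral_smoothApprox_sub_sq_le [IsProbabilityMeasure P] {ℓ₀ : ℕ} {k₀ : ℝ}
    (hk₀ : 0 < k₀) (h : IsNestedSimulation P scen U ψ)
    (hvar : InnerVarianceBound P U ψ 2 σsq) (hratio : RatioDensityBound P scen ψ c σsq)
    (hdens : InnerDensityBound P scen U ψ c ℓ₀) :
    ∃ B : ℝ, 0 ≤ B ∧ ∀ ℓ, ∫ s, (smoothApprox scen U ψ c k₀ 2 ℓ₀ ℓ s -
      if 0 < condMean ψ (scen s) - c then 1 else 0) ^ 2 ∂P ≤ B / 2 ^ ℓ := by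
  obtain ⟨K₁, hK₁, hr⟩ := exists_lintegral_ratio_le h hvar.measurable hratio
  obtain ⟨K₂, hK₂, hi⟩ := exists_lintegral_innerEst_le h hdens
  -- Each error carries a factor `2` from `(x + y)² ≤ 2 (x² + y²)`, and misclassification another
  -- `2` from the Chebyshev bound.
  refine ⟨2 * (K₂ / k₀) + 4 * K₁, by positivity, fun ℓ => ?_⟩
  set m := innerSize ℓ₀ ℓ with hm
  have hm1 : 1 ≤ m := Nat.one_le_two_pow
  have hm2 : (2 : ℝ) ^ ℓ ≤ m := by
    rw [hm, innerSize]; push_cast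
    exact pow_le_pow_right₀ one_le_two (Nat.le_add_right _ _)
  have hmpos : (0 : ℝ) < m := by exact_mod_cast hm1
  have hkpos : 0 < k₀ * 2 ^ ℓ := by positivity
  -- The event containing misclassification is posed on pairs (scenario, point sequence), so that
  -- independence allows Chebyshev with the scenario frozen.
  set A : Set (Ω × (ℕ → Fin d → ℝ)) := {p | |condMean ψ p.1 - c| ≤
    |(1 / (m : ℝ)) * ∑ j ∈ Finset.range m, ψ (p.2 j) p.1 - condMean ψ p.1|} with hA
  have hg : Measurable fun p : Ω × (ℕ → Fin d → ℝ) => condMean ψ p.1 :=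
    h.measurable_condMean.comp measurable_fst
  have hAm : MeasurableSet A :=
    measurableSet_le (hg.sub_const c).abs ((h.measurable_average m).sub hg).abs
  have hmis : ∫⁻ s, A.indicator 1 (scen s, fun j => U j s) ∂P
      ≤ ENNReal.ofReal (2 * (K₁ / m)) := by
    rw [h.lintegral_eq (measurable_one.indicator hAm)]
    calc ∫⁻ s, ∫⁻ t, A.indicator 1 (scen s, fun j => U j t) ∂P ∂P
        ≤ ∫⁻ s, ENNReal.ofReal 2 * ENNReal.ofReal (1 + (m *
            (|condMean ψ (scen s) - c| / Real.sqrt (σsq (scen s)))) ^ 2)⁻¹ ∂P := by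
          refine lintegral_mono fun s => ?_
          refine le_trans ?_ (hvar.measure_le_abs_sub_le (c := c) h hm1 (scen s))
          have hmeas : MeasurableSet ((fun t => (scen s, fun j => U j t)) ⁻¹' A) :=
            (measurable_const.prodMk h.measurable_pointSeq) hAm
          exact (lintegral_indicator_one hmeas).le
      _ = ENNReal.ofReal 2 * ∫⁻ s, ENNReal.ofReal (1 + (m *
            (|condMean ψ (scen s) - c| / Real.sqrt (σsq (scen s)))) ^ 2)⁻¹ ∂P :=
          lintegral_const_mul' _ _ ENNReal.ofReal_ne_top
      _ ≤ ENNReal.ofReal (2 * (K₁ / m)) := by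
          rw [ENNReal.ofReal_mul zero_le_two]
          exact mul_le_mul_right (hr m hmpos) _
  have hpt : ∀ s, ENNReal.ofReal ((smoothApprox scen U ψ c k₀ 2 ℓ₀ ℓ s -
      if 0 < condMean ψ (scen s) - c then 1 else 0) ^ 2) ≤
      ENNReal.ofReal 2 * ENNReal.ofReal
        (1 + (k₀ * 2 ^ ℓ * (innerEst U ψ m (scen s) s - c)) ^ 2)⁻¹ +
      ENNReal.ofReal 2 * A.indicator 1 (scen s, fun j => U j s) := fun s => by
    have h1 := sigmoid_sub_indicator_sq_le (innerEst U ψ m (scen s) s - c) hkpos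
    have h2 := ite_pos_sub_ite_pos_sq_le (innerEst U ψ m (scen s) s - c)
      (condMean ψ (scen s) - c)
    rw [sub_sub_sub_cancel_right] at h2
    have hind : A.indicator (1 : Ω × (ℕ → Fin d → ℝ) → ℝ≥0∞) (scen s, fun j => U j s) = ENNReal.ofReal
        (if |condMean ψ (scen s) - c| ≤ |innerEst U ψ m (scen s) s - condMean ψ (scen s)|
          then 1 else 0) := by
      rw [Set.indicator_apply]
      change (if |condMean ψ (scen s) - c| ≤
        |innerEst U ψ m (scen s) s - condMean ψ (scen s)| then _ else _) = _
      split_ifs <;> simp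
    rw [hind, ← ENNReal.ofReal_mul zero_le_two, ← ENNReal.ofReal_mul zero_le_two,
      ← ENNReal.ofReal_add (by positivity) (by positivity)]
    refine ENNReal.ofReal_le_ofReal ?_
    rw [smoothApprox, ← hm]
    rw [← mul_add]
    refine le_trans ?_ (mul_le_mul_of_nonneg_left (add_le_add h1 h2) zero_le_two)
    refine le_trans (le_of_eq ?_) (add_sq_le)
    ring
  have htot : ∫⁻ s, ENNReal.ofReal ((smoothApprox scen U ψ c k₀ 2 ℓ₀ ℓ s -
      if 0 < condMean ψ (scen s) - c then 1 else 0) ^ 2) ∂P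
      ≤ ENNReal.ofReal ((2 * (K₂ / k₀) + 4 * K₁) / 2 ^ ℓ) := by
    refine (lintegral_mono hpt).trans ?_
    have hmeas : Measurable fun s => ENNReal.ofReal 2 * ENNReal.ofReal
        (1 + (k₀ * 2 ^ ℓ * (innerEst U ψ m (scen s) s - c)) ^ 2)⁻¹ := by
      have := h.measurable_innerEst m
      fun_prop
    rw [lintegral_add_left hmeas, lintegral_const_mul' _ _ ENNReal.ofReal_ne_top,
      lintegral_const_mul' _ _ ENNReal.ofReal_ne_top]
    refine (add_le_add (mul_le_mul_right (hi ℓ _ hkpos) _) (mul_le_mul_right hmis _)).trans ?_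
    rw [← ENNReal.ofReal_mul zero_le_two, ← ENNReal.ofReal_mul zero_le_two,
      ← ENNReal.ofReal_add (by positivity) (by positivity)]
    refine ENNReal.ofReal_le_ofReal ?_
    have : K₁ / m ≤ K₁ / 2 ^ ℓ := div_le_div_of_nonneg_left hK₁ (by positivity) hm2
    calc 2 * (K₂ / (k₀ * 2 ^ ℓ)) + 2 * (2 * (K₁ / m))
        ≤ 2 * (K₂ / (k₀ * 2 ^ ℓ)) + 2 * (2 * (K₁ / 2 ^ ℓ)) := by gcongr
      _ = _ := by field_simp; ring
  have hmeas : Measurable fun s => (smoothApprox scen U ψ c k₀ 2 ℓ₀ ℓ s -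
      if 0 < condMean ψ (scen s) - c then 1 else 0) ^ 2 := by
    have h1 : Measurable (smoothApprox scen U ψ c k₀ 2 ℓ₀ ℓ) :=
      (measurable_sigmoid _).comp ((h.measurable_innerEst _).sub_const c)
    refine (h1.sub (Measurable.ite ?_ measurable_const measurable_const)).pow_const 2
    exact measurableSet_lt measurable_const
      ((h.measurable_condMean.comp h.measurable_scen).sub_const c)
  rw [integral_eq_lintegral_of_nonneg_ae (Filter.Eventually.of_forall fun s => by positivity)
    hmeas.aestronglyMeasurable]
  exact ENNReal.toReal_le_of_le_ofReal (by positivity) htot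

end Nested

/-! ### Cost, bias and variance per level. -/

lemma sampleCost_le (κ : UnitCosts) (ℓ₀ ℓ : ℕ) :
    sampleCost κ ℓ₀ ℓ ≤ (κ.scenario + 2 ^ ℓ₀ * κ.inner + κ.output : ℝ) * 2 ^ ℓ := by
  have h1 : (1 : ℝ) ≤ 2 ^ ℓ := one_le_pow₀ one_le_two
  have hs : (κ.scenario : ℝ) ≤ κ.scenario * 2 ^ ℓ := le_mul_of_one_le_right κ.scenario.2 h1
  have ho : (κ.output : ℝ) ≤ κ.output * 2 ^ ℓ := le_mul_of_one_le_right κ.output.2 h1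
  rw [sampleCost, innerSize]
  push_cast
  rw [pow_add]
  linarith

section Levels

variable {S Ω : Type*} [MeasurableSpace S] [MeasurableSpace Ω] {d : ℕ} {P : Measure S}
  {scen : S → Ω} {U : ℕ → S → (Fin d → ℝ)} {ψ : (Fin d → ℝ) → Ω → ℝ} {c k₀ r : ℝ} {ℓ₀ : ℕ}

lemma IsNestedSimulation.memLp_smoothApprox [IsProbabilityMeasure P]
    (h : IsNestedSimulation P scen U ψ) (ℓ : ℕ) : MemLp (smoothApprox scen U ψ c k₀ r ℓ₀ ℓ) 2 P := by
  have hm : Measurable (smoothApprox scen U ψ c k₀ r ℓ₀ ℓ) :=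
    (measurable_sigmoid _).comp ((h.measurable_innerEst _).sub_const c)
  refine MemLp.of_bound hm.aestronglyMeasurable 1 (Filter.Eventually.of_forall fun s => ?_)
  rw [smoothApprox, Real.norm_of_nonneg (sigmoid_nonneg _ _)]
  exact sigmoid_le_one _ _

lemma IsNestedSimulation.memLp_smoothDiff [IsProbabilityMeasure P]
    (h : IsNestedSimulation P scen U ψ) (ℓ : ℕ) : MemLp (smoothDiff scen U ψ c k₀ r ℓ₀ ℓ) 2 P := by
  cases ℓ with
  | zero => exact h.memLp_smoothApprox 0
  | succ ℓ => exact (h.memLp_smoothApprox (ℓ + 1)).sub (h.memLp_smoothApprox ℓ)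

lemma IsNestedSimulation.measurableSet_exceed (h : IsNestedSimulation P scen U ψ) :
    MeasurableSet {s | 0 < condMean ψ (scen s) - c} :=
  measurableSet_lt measurable_const
    ((h.measurable_condMean.comp h.measurable_scen).sub_const c)

lemma IsNestedSimulation.memLp_exceed [IsProbabilityMeasure P]
    (h : IsNestedSimulation P scen U ψ) :
    MemLp (fun s => if 0 < condMean ψ (scen s) - c then (1 : ℝ) else 0) 2 P := by
  refine MemLp.of_bound (Measurable.ite h.measurableSet_exceed measurable_const
    measurable_const).aestronglyMeasurable 1 (Filter.Eventually.of_forall fun s => ?_)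
  split_ifs <;> simp

lemma IsNestedSimulation.integral_exceed (h : IsNestedSimulation P scen U ψ) :
    ∫ s, (if 0 < condMean ψ (scen s) - c then (1 : ℝ) else 0) ∂P = target P scen ψ c := by
  have := integral_indicator_one (μ := P) (h.measurableSet_exceed (c := c))
  simp only [Set.indicator_apply, Set.mem_ofPred_eq, Pi.one_apply] at this
  rw [this, target]
  simp only [sub_pos]

lemma IsNestedSimulation.sum_integral_smoothDiff [IsProbabilityMeasure P]
    (h : IsNestedSimulation P scen U ψ) (L : ℕ) :
    ∑ ℓ ∈ Finset.range (L + 1), ∫ s, smoothDiff scen U ψ c k₀ r ℓ₀ ℓ s ∂P =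
      ∫ s, smoothApprox scen U ψ c k₀ r ℓ₀ L s ∂P := by
  induction L with
  | zero => simp [smoothDiff]
  | succ L ih =>
    rw [Finset.sum_range_succ, ih]
    simp only [smoothDiff]
    rw [integral_sub ((h.memLp_smoothApprox _).integrable one_le_two)
      ((h.memLp_smoothApprox _).integrable one_le_two)]
    ring

lemma sq_integral_le [IsProbabilityMeasure P] {X : S → ℝ} (hX : MemLp X 2 P) :
    (∫ s, X s ∂P) ^ 2 ≤ ∫ s, X s ^ 2 ∂P := by
  have := integral_sub_const_sq hX 0
  simp only [sub_zero] at this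
  linarith [variance_nonneg X P]

lemma variance_le_integral_sq [IsProbabilityMeasure P] {X : S → ℝ} (hX : MemLp X 2 P) :
    Var[X; P] ≤ ∫ s, X s ^ 2 ∂P :=
  variance_le_expectation_sq hX.aestronglyMeasurable

/-- A mean square rate `2^(-ℓ)` of the approximations bounds the variances of the corrections. -/
lemma IsNestedSimulation.variance_smoothDiff_le [IsProbabilityMeasure P]
    (h : IsNestedSimulation P scen U ψ) {B : ℝ} (hB : 0 ≤ B)
    (hrate : ∀ ℓ, ∫ s, (smoothApprox scen U ψ c k₀ r ℓ₀ ℓ s -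
      if 0 < condMean ψ (scen s) - c then 1 else 0) ^ 2 ∂P ≤ B / 2 ^ ℓ) (ℓ : ℕ) :
    Var[smoothDiff scen U ψ c k₀ r ℓ₀ ℓ; P] ≤ (6 * B + 1) / 2 ^ ℓ := by
  refine (variance_le_integral_sq (h.memLp_smoothDiff ℓ)).trans ?_
  cases ℓ with
  -- Level `0` is not a difference; its values lie in `[0, 1]`, which accounts for the `+ 1` in the
  -- constant.
  | zero =>
    have : ∫ s, smoothDiff scen U ψ c k₀ r ℓ₀ 0 s ^ 2 ∂P ≤ ∫ _, (1 : ℝ) ∂P :=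
      integral_mono (h.memLp_smoothDiff 0).integrable_sq (integrable_const _)
        fun s => pow_le_one₀ (sigmoid_nonneg _ _) (sigmoid_le_one _ _)
    refine this.trans ?_
    simp
    linarith
  | succ ℓ =>
    have hI := h.memLp_exceed (c := c)
    have h1 := ((h.memLp_smoothApprox (c := c) (k₀ := k₀) (r := r) (ℓ₀ := ℓ₀) (ℓ + 1)).sub
      hI).integrable_sq
    have h0 := ((h.memLp_smoothApprox (c := c) (k₀ := k₀) (r := r) (ℓ₀ := ℓ₀) ℓ).sub
      hI).integrable_sq
    -- The correction is the difference of the errors of two consecutive approximations of the same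
    -- indicator.
    have hle := integral_mono (h.memLp_smoothDiff (c := c) (k₀ := k₀) (r := r) (ℓ₀ := ℓ₀)
      (ℓ + 1)).integrable_sq ((h1.const_mul 2).add (h0.const_mul 2)) fun s => by
        simp only [smoothDiff, Pi.add_apply, Pi.sub_apply]
        nlinarith [sq_nonneg ((smoothApprox scen U ψ c k₀ r ℓ₀ (ℓ + 1) s -
          if 0 < condMean ψ (scen s) - c then 1 else 0) + (smoothApprox scen U ψ c k₀ r ℓ₀ ℓ s -
          if 0 < condMean ψ (scen s) - c then 1 else 0))]
    refine hle.trans ?_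
    simp only [Pi.add_apply]
    rw [integral_add (h1.const_mul 2) (h0.const_mul 2), integral_const_mul, integral_const_mul]
    simp only [Pi.sub_apply]
    refine (add_le_add (mul_le_mul_of_nonneg_left (hrate (ℓ + 1)) zero_le_two)
      (mul_le_mul_of_nonneg_left (hrate ℓ) zero_le_two)).trans ?_
    calc 2 * (B / 2 ^ (ℓ + 1)) + 2 * (B / 2 ^ ℓ) = 6 * B / 2 ^ (ℓ + 1) := by
          rw [pow_succ]; field_simp; ring
      _ ≤ _ := by gcongr; linarith

/-- The sum of means telescopes, so the bias is the mean of the last approximation error and Jensen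
applies. -/
lemma IsNestedSimulation.bias_sq_le [IsProbabilityMeasure P]
    (h : IsNestedSimulation P scen U ψ) (L : ℕ) :
    (∑ ℓ ∈ Finset.range (L + 1), ∫ s, smoothDiff scen U ψ c k₀ r ℓ₀ ℓ s ∂P -
      target P scen ψ c) ^ 2 ≤ ∫ s, (smoothApprox scen U ψ c k₀ r ℓ₀ L s -
      if 0 < condMean ψ (scen s) - c then 1 else 0) ^ 2 ∂P := by
  have hA := h.memLp_smoothApprox (c := c) (k₀ := k₀) (r := r) (ℓ₀ := ℓ₀) L
  have hI := h.memLp_exceed (c := c)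
  rw [h.sum_integral_smoothDiff, ← h.integral_exceed,
    ← integral_sub (hA.integrable one_le_two) (hI.integrable one_le_two)]
  exact sq_integral_le (hA.sub hI)

end Levels

end NestedMLMC

theorem theorem3p3 {S : Type*} {Ω : Type*} [MeasurableSpace S] [MeasurableSpace Ω] {d : ℕ}
    (P : Measure S) [IsProbabilityMeasure P]
    (scen : S → Ω) (U : ℕ → S → (Fin d → ℝ)) (ψ : (Fin d → ℝ) → Ω → ℝ)
    (hmodel : NestedMLMC.IsNestedSimulation P scen U ψ)
    (c : ℝ) (ℓ₀ : ℕ) (k₀ : ℝ) (hk₀ : 0 < k₀) (σsq : Ω → ℝ)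
    (hvar : NestedMLMC.InnerVarianceBound P U ψ 2 σsq)
    (hratio : NestedMLMC.RatioDensityBound P scen ψ c σsq)
    (hdens : NestedMLMC.InnerDensityBound P scen U ψ c ℓ₀)
    (κ : NestedMLMC.UnitCosts) :
    ∃ c₄ : ℝ, 0 < c₄ ∧ ∀ ε : ℝ, 0 < ε → ε < 1 / Real.exp 1 →
      ∃ (L : ℕ) (N : ℕ → ℕ), (∀ ℓ ≤ L, 1 ≤ N ℓ) ∧
        (∀ {S' : Type*} [MeasurableSpace S'] (Q : Measure S') [IsProbabilityMeasure Q]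
          (Yrep : ℕ → ℕ → S' → ℝ),
          NestedMLMC.IsReplication P
            (NestedMLMC.smoothDiff scen U ψ c k₀ 2 ℓ₀) Q Yrep →
          ∫ s, (NestedMLMC.mlmcEstimator Yrep L N s - NestedMLMC.target P scen ψ c) ^ 2 ∂Q
            ≤ ε ^ 2) ∧
        NestedMLMC.totalCost κ ℓ₀ L N ≤ c₄ * (ε ^ (-2 : ℤ) * Real.log ε ^ 2) := by
  obtain ⟨B, hB, hrate⟩ :=
    NestedMLMC.exists_integral_smoothApprox_sub_sq_le hk₀ hmodel hvar hratio hdens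
  -- The constant `6 * B + 1` dominates both the squared bias and the variances, and is at least
  -- `1`.
  obtain ⟨c₄, hc₄, hsizes⟩ := NestedMLMC.exists_level_sampleSizes
    (B := 6 * B + 1) (by linarith) (by positivity) _ (NestedMLMC.sampleCost_le κ ℓ₀)
  refine ⟨c₄, hc₄, fun ε hε hε' => ?_⟩
  obtain ⟨L, N, hN, hbias, hvariance, hcost⟩ := hsizes ε hε hε'
  refine ⟨L, N, fun ℓ _ => hN ℓ, ?_, hcost⟩
  intro S' _ Q _ Yrep hrep
  rw [hrep.integral_mlmcEstimator_sub_sq hmodel.memLp_smoothDiff L hN]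
  have h1 : ∑ ℓ ∈ Finset.range (L + 1),
      Var[NestedMLMC.smoothDiff scen U ψ c k₀ 2 ℓ₀ ℓ; P] / (N ℓ : ℝ) ≤ ε ^ 2 / 2 :=
    (Finset.sum_le_sum fun ℓ _ => div_le_div_of_nonneg_right
      (hmodel.variance_smoothDiff_le hB hrate ℓ) (Nat.cast_nonneg _)).trans hvariance
  have h2 : B / 2 ^ L ≤ (6 * B + 1) / 2 ^ L :=
    div_le_div_of_nonneg_right (by linarith) (by positivity)
  linarith [(hmodel.bias_sq_le (c := c) (k₀ := k₀) (r := 2) (ℓ₀ := ℓ₀) L).trans (hrate L)]
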